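/- For complex $s,v$ with $v\notin\{0,-1,-2,\dots\}$ let $\Phi(z,s,v)$ be the Hurwitz–Lerch zeta function: for $|z|<1$ it is $\sum_{j\ge 0}(v+j)^{-s}z^{j}$ (principal powers); for $z\in\mathbb C\setminus[1,\infty)$ it is the analytic continuation of this series in $z$; for $z=1$ and $s\ne 1$ it is the Hurwitz zeta function $\zeta(s,v)$, i.e. the analytic continuation in $s$ of $\sum_{j\ge0}(v+j)^{-s}$; and for $s\in\{0,-1,-2,\dots\}$, where $\Phi$ is a rational function of $z$, it is also defined by continuity for $z\in(1,\infty)$. **Theorem.** Let $k,a,m\in\mathbb C$ with $a\neq0$, let $n$ be a positive integer, and let $\log a$ be any value of the logarithm of $a$. Suppose that all the values of $\Phi$ below are defined in the above sense. Then, with principal values of the powers, $$\sum_{p=0}^{n}2^{-p}e^{im2^{-p}}\Bigl((i2^{-p})^{k}e^{im2^{-p}}\,\Phi\bigl(-e^{i2^{1-p}m},-k,1-i2^{p-1}\log a\bigr)-(i2^{-p-1})^{k}\,\Phi\bigl(-e^{i2^{-p}m},-k,1-i2^{p}\log a\bigr)\Bigr)$$ $$=i\,(i2^{-n})^{k+1}e^{im2^{-n}}\,\Phi\Bigl(e^{i2^{1-n}m},-k,\tfrac12\bigl(1-i2^{n}\log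 a\bigr)\Bigr)+i^{k}2^{k+1}e^{2im}\,\Phi\Bigl(e^{4im},-k,\tfrac12-\tfrac14 i\log a\Bigr).$$ -/

import Mathlib

/-- The Lerch series `∑ (v + j)^(-s) z^j`, with principal powers. -/
noncomputable def lerchSeries (z s v : ℂ) : ℂ :=
  ∑' j : ℕ, (v + (j : ℂ)) ^ (-s) * z ^ j

/-- The plane cut along the ray `[1, ∞)`. -/
def lerchCutPlane : Set ℂ := {z : ℂ | 1 - z ∈ Complex.slitPlane}

/-- `f` is the analytic continuation in `z` of the Lerch series from the unit disc to the plane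
cut along `[1, ∞)`. -/
def IsLerchContinuation (s v : ℂ) (f : ℂ → ℂ) : Prop :=
  DifferentiableOn ℂ f lerchCutPlane ∧ ∀ z : ℂ, ‖z‖ < 1 → f z = lerchSeries z s v

/-- `g` is the Hurwitz zeta function `s ↦ ζ(s, v)`: the analytic continuation in `s`, to the
plane without the point `1`, of the series at `z = 1`, which converges for `Re s > 1`. -/
def IsHurwitzContinuation (v : ℂ) (g : ℂ → ℂ) : Prop :=
  DifferentiableOn ℂ g {(1 : ℂ)}ᶜ ∧ ∀ s : ℂ, 1 < s.re → g s = lerchSeries 1 s v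

open Classical in
/-- The Hurwitz-Lerch zeta function `Φ(z, s, v)`. Both continuations are unique on their
(connected) domains, so the value does not depend on the choice made by `epsilon`. For `z` off
the cut `[1, ∞)` the limit below is just the value at `z` of the continuation; at a point `z > 1`
of the cut it is the value to which the continuation extends continuously across the cut, if there
is one (as there is when `s = 0, -1, -2, …`, where `Φ` is a rational function of `z`).
The value is meaningful under `LerchAdmissible z s v` only. -/
noncomputable def hurwitzLerchPhi (z s v : ℂ) : ℂ :=
  if z = 1 then Classical.epsilon (IsHurwitzContinuation v) s
  else Filter.limUnder (nhdsWithin z lerchCutPlane) (Classical.epsilon (IsLerchContinuation s v))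

/-- The points at which `Φ(z, s, v)` is defined: `v` is not one of `0, -1, -2, …`, and either `z`
is off the cut `[1, ∞)`, or `z = 1` and `s` is not the pole `1` of the Hurwitz zeta function, or
`z ≠ 1` and `s` is one of `0, -1, -2, …`. -/
def LerchAdmissible (z s v : ℂ) : Prop :=
  (∀ j : ℕ, v ≠ -(j : ℂ)) ∧
    (z ∈ lerchCutPlane ∨ (z = 1 ∧ s ≠ 1) ∨ (z ≠ 1 ∧ ∃ N : ℕ, s = -(N : ℂ)))

/-!
Removing the first terms of the Lerch series moves `v` into `Re v > 0`, where `Γ(s) Φ(z, s, v)` is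
the Mellin transform of `e^(-vt) / (1 - z e^(-t))`. This continues `Φ` to the cut plane in `z`;
replacing the kernel by its images `(v + w d/dw)^N (1 - w)⁻¹` at `w = z e^(-t)` shifts the abscissa
of convergence in `s` by `N`, so `Φ` is also entire in `s` there. At `z = 1` the kernel is `1 / t`
times a function smooth at `t = 0`, whose Taylor terms are integrated in closed form as in Watson's
lemma.

Sorting the indices of the series by residue modulo `q` gives
`Φ(z, s, v) = q^(-s) ∑_{r < q} z^r Φ(z^q, s, (v + r) / q)`, which persists by analytic continuation
in `z`, or in `s` when `z^q = 1`. Applied with `q = 2` at the arguments `-w`, `w²`, `-w²` with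
`w = e^(i 2^(-p) m)`, it writes the `p`-th summand of the theorem as a difference
`T (p - 1) - T p` of Lerch series over odd indices, and the sum telescopes to `T (-1) - T n`.
-/

open Complex MeasureTheory Filter Topology Set Asymptotics

section ParametricIntegral

variable {α E : Type*} [MeasurableSpace α] {μ : Measure α} [NormedAddCommGroup E]

theorem aestronglyMeasurable_deriv_of_eventually {𝕜 : Type*} [NontriviallyNormedField 𝕜]
    [NormedSpace 𝕜 E] {F : 𝕜 → α → E} {z₀ : 𝕜}
    (hmeas : ∀ᶠ z in 𝓝 z₀, AEStronglyMeasurable (F z) μ)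
    (hdiff : ∀ᵐ t ∂μ, DifferentiableAt 𝕜 (fun z => F z t) z₀) :
    AEStronglyMeasurable (fun t => deriv (fun z => F z t) z₀) μ := by
  obtain ⟨u, hu, hmeas_u⟩ := exists_seq_forall_of_frequently
    (hmeas.filter_mono (nhdsWithin_le_nhds (s := {z₀}ᶜ))).frequently
  refine aestronglyMeasurable_of_tendsto_ae atTop
    (f := fun n t => slope (fun z => F z t) z₀ (u n)) (fun n => ?_) ?_
  · exact ((hmeas_u n).sub hmeas.self_of_nhds).const_smul (u n - z₀)⁻¹
  · filter_upwards [hdiff] with t ht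
    exact (hasDerivAt_iff_tendsto_slope.1 ht.hasDerivAt).comp hu

theorem differentiableOn_integral_of_locally_dominated [NormedSpace ℂ E]
    {F : ℂ → α → E} {U : Set ℂ} (hU : IsOpen U)
    (hmeas : ∀ z ∈ U, AEStronglyMeasurable (F z) μ)
    (hdiff : ∀ᵐ t ∂μ, DifferentiableOn ℂ (fun z => F z t) U)
    (hbound : ∀ z₀ ∈ U, ∃ V ∈ 𝓝 z₀, ∃ b : α → ℝ, Integrable b μ ∧
      ∀ᵐ t ∂μ, ∀ z ∈ V, ‖F z t‖ ≤ b t) :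
    DifferentiableOn ℂ (fun z => ∫ t, F z t ∂μ) U := by
  intro z₀ hz₀
  obtain ⟨V, hV, b, hb, hFb⟩ := hbound z₀ hz₀
  obtain ⟨ε, hε, hεV⟩ := Metric.nhds_basis_closedBall.mem_iff.1 (inter_mem hV (hU.mem_nhds hz₀))
  have hball : ∀ z ∈ Metric.ball z₀ (ε / 2), Metric.closedBall z (ε / 2) ⊆ V ∩ U := fun z hz =>
    (Metric.closedBall_subset_closedBall' (by linarith [Metric.mem_ball.1 hz])).trans hεV
  have hdiffAt : ∀ᵐ t ∂μ, ∀ z ∈ U, DifferentiableAt ℂ (fun z => F z t) z := by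
    filter_upwards [hdiff] with t ht z hz using (ht z hz).differentiableAt (hU.mem_nhds hz)
  have hmeas_nhds : ∀ᶠ z in 𝓝 z₀, AEStronglyMeasurable (F z) μ :=
    eventually_of_mem (hU.mem_nhds hz₀) hmeas
  refine (hasDerivAt_integral_of_dominated_loc_of_deriv_le (bound := fun t => b t / (ε / 2))
    (F' := fun z t => deriv (fun z => F z t) z) (Metric.ball_mem_nhds z₀ (half_pos hε))
    hmeas_nhds ?_ ?_ ?_ (hb.div_const _) ?_).2.differentiableAt.differentiableWithinAt
  · refine hb.mono' (hmeas _ hz₀) ?_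
    filter_upwards [hFb] with t ht using ht z₀ (mem_of_mem_nhds hV)
  · exact aestronglyMeasurable_deriv_of_eventually hmeas_nhds (hdiffAt.mono fun t ht => ht z₀ hz₀)
  -- Cauchy's estimate turns the bound on `F` into one on its derivative.
  · filter_upwards [hFb, hdiff] with t ht htd z hz
    refine norm_deriv_le_of_forall_mem_sphere_norm_le (half_pos hε)
      (htd.diffContOnCl_ball fun w hw => (hball z hz hw).2) fun w hw => ht w ?_
    exact (hball z hz (Metric.sphere_subset_closedBall hw)).1
  · filter_upwards [hdiffAt] with t ht z hz
    exact (ht z (hball z hz (Metric.mem_closedBall_self (half_pos hε).le)).2).hasDerivAt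

end ParametricIntegral

section Mellin

theorem integrableOn_rpow_mul_exp_neg_mul {σ r : ℝ} (hσ : 0 < σ) (hr : 0 < r) :
    IntegrableOn (fun t : ℝ => t ^ (σ - 1) * Real.exp (-(r * t))) (Ioi 0) := by
  simpa using integrableOn_rpow_mul_exp_neg_mul_rpow (s := σ - 1) (by linarith) one_pos hr

theorem continuousOn_cpow_const_Ioi (s : ℂ) : ContinuousOn (fun t : ℝ => (t : ℂ) ^ s) (Ioi 0) :=
  fun t ht => (continuousAt_ofReal_cpow_const t s (Or.inr (ne_of_gt ht))).continuousWithinAt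

theorem differentiableOn_mellin_of_exp_bound {E : Type*} [NormedAddCommGroup E] [NormedSpace ℂ E]
    {F : ℂ → ℝ → E} {U : Set ℂ} {s : ℂ} (hs : 0 < s.re) (hU : IsOpen U)
    (hcont : ∀ z ∈ U, ContinuousOn (F z) (Ioi 0))
    (hdiff : ∀ t : ℝ, 0 < t → DifferentiableOn ℂ (fun z => F z t) U)
    (hbound : ∀ z₀ ∈ U, ∃ V ∈ 𝓝 z₀, ∃ C r : ℝ, 0 < r ∧
      ∀ z ∈ V, ∀ t : ℝ, 0 < t → ‖F z t‖ ≤ C * Real.exp (-(r * t))) :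
    DifferentiableOn ℂ (fun z => mellin (F z) s) U := by
  refine differentiableOn_integral_of_locally_dominated hU (fun z hz => ?_) ?_ fun z₀ hz₀ => ?_
  · exact ((continuousOn_cpow_const_Ioi _).smul (hcont z hz)).aestronglyMeasurable
      measurableSet_Ioi
  · filter_upwards [ae_restrict_mem measurableSet_Ioi] with t ht
    exact (hdiff t ht).const_smul _
  · obtain ⟨V, hV, C, r, hr, hFb⟩ := hbound z₀ hz₀
    refine ⟨V, hV, _, (integrableOn_rpow_mul_exp_neg_mul hs hr).const_mul C, ?_⟩
    filter_upwards [ae_restrict_mem measurableSet_Ioi] with t ht z hz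
    have ht0 : 0 < t := ht
    rw [norm_smul, norm_cpow_eq_rpow_re_of_pos ht0, sub_re, one_re, mul_left_comm]
    gcongr
    exact hFb z hz t ht0

theorem norm_exp_neg_mul_ofReal (v : ℂ) (t : ℝ) :
    ‖exp (-(v * t))‖ = Real.exp (-(v.re * t)) := by
  rw [norm_exp, neg_re, re_mul_ofReal]

theorem norm_cpow_smul_exp_neg_mul {t : ℝ} (ht : 0 < t) (s v : ℂ) :
    ‖(t : ℂ) ^ (s - 1) • exp (-(v * t))‖ = t ^ (s.re - 1) * Real.exp (-(v.re * t)) := by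
  rw [norm_smul, norm_cpow_eq_rpow_re_of_pos ht, norm_exp_neg_mul_ofReal, sub_re, one_re]

theorem mellinConvergent_exp_neg_mul {s v : ℂ} (hs : 0 < s.re) (hv : 0 < v.re) :
    MellinConvergent (fun t : ℝ => exp (-(v * t))) s := by
  refine (integrableOn_rpow_mul_exp_neg_mul hs hv).mono' (ContinuousOn.aestronglyMeasurable
    ((continuousOn_cpow_const_Ioi _).smul (by fun_prop)) measurableSet_Ioi) ?_
  filter_upwards [ae_restrict_mem measurableSet_Ioi] with t ht
  exact (norm_cpow_smul_exp_neg_mul ht s v).le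

theorem mellin_exp_neg_ofReal_mul {s : ℂ} (hs : 0 < s.re) {r : ℝ} (hr : 0 < r) :
    mellin (fun t : ℝ => exp (-((r : ℂ) * t))) s = Gamma s * (r : ℂ) ^ (-s) := by
  have harg : (r : ℂ).arg ≠ Real.pi := by
    rw [arg_ofReal_of_nonneg hr.le]
    exact Real.pi_pos.ne
  rw [cpow_neg, ← inv_cpow _ _ harg, ← one_div, mul_comm,
    ← integral_cpow_mul_exp_neg_mul_Ioi hs hr]
  rfl

theorem hasMellin_exp_neg_mul {s v : ℂ} (hs : 0 < s.re) (hv : 0 < v.re) :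
    HasMellin (fun t : ℝ => exp (-(v * t))) s (Gamma s * v ^ (-s)) := by
  refine ⟨mellinConvergent_exp_neg_mul hs hv, ?_⟩
  have hopen : IsOpen {v : ℂ | 0 < v.re} := isOpen_lt continuous_const continuous_re
  have hmellin : DifferentiableOn ℂ (fun v : ℂ => mellin (fun t : ℝ => exp (-(v * t))) s)
      {v : ℂ | 0 < v.re} := by
    refine differentiableOn_mellin_of_exp_bound hs hopen (fun v _ => by fun_prop)
      (fun t _ => by fun_prop) fun v₀ (hv₀ : 0 < v₀.re) => ?_
    refine ⟨{v | v₀.re / 2 < v.re}, (isOpen_lt continuous_const continuous_re).mem_nhds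
      (half_lt_self hv₀), 1, v₀.re / 2, half_pos hv₀, fun v (hv : v₀.re / 2 < v.re) t ht => ?_⟩
    rw [norm_exp_neg_mul_ofReal, one_mul]
    gcongr
  have hpow : DifferentiableOn ℂ (fun v : ℂ => Gamma s * v ^ (-s)) {v : ℂ | 0 < v.re} := fun v hv =>
    ((differentiableAt_id.cpow_const (Or.inl hv)).const_mul _).differentiableWithinAt
  refine (hmellin.analyticOnNhd hopen).eqOn_of_preconnected_of_frequently_eq
    (hpow.analyticOnNhd hopen) (convex_halfSpace_re_gt 0).isPreconnected (z₀ := 1) (by simp) ?_ hv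
  have hreal : Tendsto (fun r : ℝ => (r : ℂ)) (𝓝[≠] 1) (𝓝[≠] 1) := by
    refine tendsto_nhdsWithin_iff.2 ⟨?_, eventually_nhdsWithin_of_forall fun r hr => ?_⟩
    · exact (continuous_ofReal.tendsto' 1 1 ofReal_one).mono_left nhdsWithin_le_nhds
    · exact fun h => hr (ofReal_eq_one.1 h)
  refine hreal.frequently (Eventually.frequently ?_)
  filter_upwards [nhdsWithin_le_nhds (lt_mem_nhds one_pos)] with r hr
    using mellin_exp_neg_ofReal_mul hs hr

theorem integral_norm_cpow_smul_exp_neg_mul {s v : ℂ} (hs : 0 < s.re) (hv : 0 < v.re) :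
    ∫ t : ℝ in Ioi 0, ‖(t : ℂ) ^ (s - 1) • exp (-(v * t))‖
      = Real.Gamma s.re * v.re ^ (-s.re) := by
  rw [setIntegral_congr_fun measurableSet_Ioi fun t ht => norm_cpow_smul_exp_neg_mul ht s v,
    Real.integral_rpow_mul_exp_neg_mul_Ioi hs hv, one_div, Real.inv_rpow hv.le,
    ← Real.rpow_neg hv.le, mul_comm]

theorem re_add_natCast_pos {v : ℂ} (hv : 0 < v.re) (j : ℕ) : 0 < (v + j).re := by
  rw [add_re, natCast_re]
  positivity

theorem hasSum_mellin_exp_neg_mul {s v : ℂ} (hs : 0 < s.re) (hv : 0 < v.re) {a : ℕ → ℂ}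
    {f : ℝ → ℂ} (hf : ∀ t : ℝ, 0 < t → HasSum (fun j : ℕ => a j * exp (-t) ^ j) (f t))
    (ha : Summable fun j : ℕ => ‖a j‖ * (v.re + j) ^ (-s.re)) :
    HasSum (fun j : ℕ => Gamma s * (a j * (v + j) ^ (-s)))
      (mellin (fun t : ℝ => exp (-(v * t)) * f t) s) := by
  have hmellin (j : ℕ) := hasMellin_exp_neg_mul hs (re_add_natCast_pos hv j)
  have hint (j : ℕ) : ∫ t : ℝ in Ioi 0, ‖a j * (t : ℂ) ^ (s - 1) • exp (-((v + j) * t))‖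
      = Real.Gamma s.re * (‖a j‖ * (v.re + j) ^ (-s.re)) := by
    simp_rw [norm_mul (a j)]
    rw [integral_const_mul, integral_norm_cpow_smul_exp_neg_mul hs (re_add_natCast_pos hv j),
      add_re, natCast_re]
    ring
  have hsum := hasSum_integral_of_summable_integral_norm (μ := volume.restrict (Ioi (0 : ℝ)))
    (F := fun (j : ℕ) (t : ℝ) => a j * (t : ℂ) ^ (s - 1) • exp (-((v + j) * t)))
    (fun j => (hmellin j).1.const_mul _) (by simp_rw [hint]; exact ha.mul_left _)
  have hterm (j : ℕ) : ∫ t : ℝ in Ioi 0, a j * (t : ℂ) ^ (s - 1) • exp (-((v + j) * t))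
      = Gamma s * (a j * (v + j) ^ (-s)) := by
    rw [integral_const_mul, ← mellin, (hmellin j).2]
    ring
  have htsum : ∫ t : ℝ in Ioi 0, ∑' j : ℕ, a j * (t : ℂ) ^ (s - 1) • exp (-((v + j) * t))
      = mellin (fun t : ℝ => exp (-(v * t)) * f t) s := by
    refine setIntegral_congr_fun measurableSet_Ioi fun t ht => ?_
    simp only [smul_eq_mul]
    rw [← mul_assoc, ← ((hf t ht).mul_left _).tsum_eq]
    refine tsum_congr fun j => ?_
    rw [add_mul, neg_add, exp_add, ← exp_nat_mul]
    ring_nf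
  simpa only [hterm, htsum] using hsum

end Mellin

section LerchSeries

/-- The region of absolute convergence of the Lerch series: the open unit disc, together with its
boundary circle when `Re s > 1`. -/
def LerchConvergent (z s : ℂ) : Prop :=
  ‖z‖ < 1 ∨ ‖z‖ ≤ 1 ∧ 1 < s.re

theorem isTheta_norm_add_natCast (v : ℂ) :
    (fun j : ℕ => ‖v + j‖) =Θ[atTop] fun j : ℕ => (j : ℝ) := by
  have h : (fun j : ℕ => (j : ℂ) + v) ~[atTop] fun j : ℕ => (j : ℂ) :=
    IsEquivalent.refl.add_isLittleO <| isLittleO_const_left.2 <| Or.inr <| by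
      simpa [Function.comp_def] using tendsto_natCast_atTop_atTop (R := ℝ)
  simpa [add_comm] using h.isTheta.norm_left.norm_right

theorem isBigO_add_natCast_cpow (v s : ℂ) :
    (fun j : ℕ => (v + j) ^ s) =O[atTop] fun j : ℕ => (j : ℝ) ^ s.re := by
  have hbase : (fun j : ℕ => ‖v + j‖ ^ s.re) =O[atTop] fun j : ℕ => (j : ℝ) ^ s.re :=
    ((isTheta_norm_add_natCast v).rpow (Eventually.of_forall fun j => norm_nonneg _)
      (Eventually.of_forall fun j => j.cast_nonneg)).1
  refine IsBigO.trans (IsBigO.of_bound (Real.exp (Real.pi * |s.im|))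
    (Eventually.of_forall fun j => ?_)) hbase
  have harg : -((v + j).arg * s.im) ≤ Real.pi * |s.im| := by
    refine (neg_le_abs _).trans ?_
    rw [abs_mul]
    exact mul_le_mul_of_nonneg_right (abs_arg_le_pi _) (abs_nonneg _)
  calc ‖(v + j) ^ s‖ ≤ ‖v + j‖ ^ s.re / Real.exp ((v + j).arg * s.im) := norm_cpow_le _ _
    _ = Real.exp (-((v + j).arg * s.im)) * ‖v + j‖ ^ s.re := by
      rw [Real.exp_neg, div_eq_mul_inv, mul_comm]
    _ ≤ Real.exp (Real.pi * |s.im|) * ‖‖v + j‖ ^ s.re‖ := by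
      rw [Real.norm_of_nonneg (by positivity)]
      gcongr

theorem summable_natCast_rpow_mul_geometric {z s : ℂ} (h : LerchConvergent z s) :
    Summable fun j : ℕ => (j : ℝ) ^ (-s.re) * ‖z‖ ^ j := by
  rcases h with hz | ⟨hz, hs⟩
  · obtain ⟨n, hn⟩ := exists_nat_ge (-s.re)
    refine Summable.of_norm_bounded_eventually_nat
      (summable_pow_mul_geometric_of_norm_lt_one (r := ‖z‖) n (by rwa [norm_norm])) ?_
    filter_upwards [eventually_ge_atTop 1] with j hj
    have hj' : (1 : ℝ) ≤ j := by exact_mod_cast hj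
    rw [Real.norm_of_nonneg (by positivity), ← Real.rpow_natCast (j : ℝ) n]
    gcongr
  · refine Summable.of_nonneg_of_le (fun j => by positivity) (fun j => ?_)
      (Real.summable_nat_rpow.2 (neg_lt_neg hs))
    exact mul_le_of_le_one_right (by positivity) (pow_le_one₀ (norm_nonneg z) hz)

theorem summable_norm_lerchSeries {z s : ℂ} (v : ℂ) (h : LerchConvergent z s) :
    Summable fun j : ℕ => ‖(v + j) ^ (-s) * z ^ j‖ := by
  refine summable_of_isBigO_nat (summable_natCast_rpow_mul_geometric h) ?_
  refine ((isBigO_add_natCast_cpow v (-s)).mul ?_).norm_left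
  simpa only [norm_pow] using (isBigO_refl (fun j : ℕ => z ^ j) atTop).norm_right

theorem summable_norm_pow_mul_rpow {z s v : ℂ} (hv : 0 < v.re) (N : ℕ)
    (h : LerchConvergent z s) :
    Summable fun j : ℕ => ‖(v + j) ^ N * z ^ j‖ * (v.re + j) ^ (-(s.re + N)) := by
  refine summable_of_isBigO_nat (summable_natCast_rpow_mul_geometric h) ?_
  have hpow : (fun j : ℕ => ‖v + j‖ ^ N) =O[atTop] fun j : ℕ => (j : ℝ) ^ N :=
    (isTheta_norm_add_natCast v).1.pow N
  have hrpow : (fun j : ℕ => (v.re + j) ^ (-(s.re + N))) =O[atTop]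
      fun j : ℕ => (j : ℝ) ^ (-(s.re + N)) := by
    refine (IsTheta.rpow (Eventually.of_forall fun j => by positivity)
      (Eventually.of_forall fun j => by positivity) ?_).1
    convert isTheta_norm_add_natCast v.re using 2 with j
    rw [← ofReal_natCast, ← ofReal_add, Complex.norm_of_nonneg (by positivity)]
  refine ((hpow.mul hrpow).mul (isBigO_refl (fun j : ℕ => ‖z‖ ^ j) atTop)).congr' ?_ ?_
  · exact Eventually.of_forall fun j => by simp only [norm_mul, norm_pow]; ring
  · filter_upwards [eventually_gt_atTop 0] with j hj
    have hj' : (0 : ℝ) < j := by exact_mod_cast hj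
    rw [← Real.rpow_natCast (j : ℝ) N, ← Real.rpow_add hj']
    ring_nf

theorem lerchSeries_eq_sum_add {z s : ℂ} (v : ℂ) (h : LerchConvergent z s) (M : ℕ) :
    lerchSeries z s v = ∑ j ∈ Finset.range M, (v + j) ^ (-s) * z ^ j
      + z ^ M * lerchSeries z s (v + M) := by
  rw [lerchSeries, ← (summable_norm_lerchSeries v h).of_norm.sum_add_tsum_nat_add M, lerchSeries,
    ← tsum_mul_left]
  congr 1
  refine tsum_congr fun j => ?_
  push_cast
  rw [pow_add]
  ring_nf

/-- The rational function `(v + w d/dw)^N (1 - w)⁻¹`, which continues `∑ (v + j)^N w^j`, the Lerch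
series at `s = -N`. -/
noncomputable def lerchRational (v : ℂ) : ℕ → ℂ → ℂ
  | 0 => fun w => (1 - w)⁻¹
  | N + 1 => fun w => v * lerchRational v N w + w * deriv (lerchRational v N) w

theorem differentiableOn_lerchRational (v : ℂ) (N : ℕ) :
    DifferentiableOn ℂ (lerchRational v N) {(1 : ℂ)}ᶜ := by
  induction N with
  | zero => exact DifferentiableOn.inv (by fun_prop) fun w hw => sub_ne_zero.2 (Ne.symm hw)
  | succ N ih =>
    exact (ih.const_mul v).add (differentiableOn_id.mul (ih.deriv isOpen_compl_singleton))

theorem hasSum_deriv_add_natCast_pow_mul_pow (v : ℂ) (N : ℕ) {w : ℂ} (hw : ‖w‖ < 1) :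
    HasSum (fun j : ℕ => deriv (fun w : ℂ => (v + j) ^ N * w ^ j) w)
      (deriv (fun w : ℂ => ∑' j : ℕ, (v + j) ^ N * w ^ j) w) := by
  obtain ⟨r, hwr, hr⟩ := exists_between hw
  have hr0 : 0 ≤ r := (norm_nonneg w).trans hwr.le
  have hsum : Summable fun j : ℕ => ‖v + j‖ ^ N * r ^ j := by
    have h : LerchConvergent r (-N) := Or.inl (by rwa [Complex.norm_of_nonneg hr0])
    simpa [abs_of_nonneg hr0] using summable_norm_lerchSeries v h
  refine hasSum_deriv_of_summable_norm (U := Metric.ball 0 r) hsum (fun j => by fun_prop)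
    Metric.isOpen_ball (fun j x hx => ?_) (mem_ball_zero_iff.2 hwr)
  rw [mem_ball_zero_iff] at hx
  rw [norm_mul, norm_pow, norm_pow]
  gcongr

theorem hasSum_lerchRational (v : ℂ) (N : ℕ) {w : ℂ} (hw : ‖w‖ < 1) :
    HasSum (fun j : ℕ => (v + j) ^ N * w ^ j) (lerchRational v N w) := by
  induction N generalizing w with
  | zero => simpa [lerchRational] using hasSum_geometric_of_norm_lt_one hw
  | succ N ih =>
    have hderiv : deriv (fun w : ℂ => ∑' j : ℕ, (v + j) ^ N * w ^ j) w
        = deriv (lerchRational v N) w := by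
      refine EventuallyEq.deriv_eq ?_
      filter_upwards [Metric.isOpen_ball.mem_nhds (mem_ball_zero_iff.2 hw)] with x hx
        using (ih (mem_ball_zero_iff.1 hx)).tsum_eq
    have hterm (j : ℕ) : (v + j) ^ (N + 1) * w ^ j
        = v * ((v + j) ^ N * w ^ j) + w * deriv (fun w : ℂ => (v + j) ^ N * w ^ j) w := by
      rw [deriv_const_mul_field, deriv_pow_field]
      cases j with
      | zero => simp [pow_succ']
      | succ j =>
        rw [Nat.add_sub_cancel]
        ring
    simp only [hterm, lerchRational, ← hderiv]
    exact ((ih hw).mul_left v).add ((hasSum_deriv_add_natCast_pow_mul_pow v N hw).mul_left w)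

end LerchSeries

section CutPlane

theorem isOpen_lerchCutPlane : IsOpen lerchCutPlane :=
  isOpen_slitPlane.preimage (continuous_const.sub continuous_id)

theorem starConvex_lerchCutPlane : StarConvex ℝ 0 lerchCutPlane := by
  rw [starConvex_zero_iff]
  intro z hz r hr0 hr1
  have hmem := starConvex_one_slitPlane hz (sub_nonneg.2 hr1) hr0 (by ring)
  rwa [show (1 - r) • (1 : ℂ) + r • (1 - z) = 1 - r • z by module] at hmem

theorem mem_lerchCutPlane_of_norm_lt_one {z : ℂ} (hz : ‖z‖ < 1) : z ∈ lerchCutPlane := by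
  have := mem_slitPlane_of_norm_lt_one (z := -z) (by rwa [norm_neg])
  rwa [← sub_eq_add_neg] at this

theorem zero_mem_lerchCutPlane : (0 : ℂ) ∈ lerchCutPlane :=
  mem_lerchCutPlane_of_norm_lt_one (by simp)

theorem isPreconnected_lerchCutPlane : IsPreconnected lerchCutPlane :=
  (starConvex_lerchCutPlane.isPathConnected zero_mem_lerchCutPlane).isConnected.isPreconnected

theorem ne_one_of_mem_lerchCutPlane {z : ℂ} (hz : z ∈ lerchCutPlane) : z ≠ 1 := by
  rintro rfl
  simp [lerchCutPlane] at hz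

theorem mem_lerchCutPlane_of_im_ne_zero {z : ℂ} (hz : z.im ≠ 0) : z ∈ lerchCutPlane :=
  Or.inr (by simpa using hz)

theorem mem_lerchCutPlane_of_norm_eq_one {z : ℂ} (hz : ‖z‖ = 1) (hz1 : z ≠ 1) :
    z ∈ lerchCutPlane := by
  refine Or.inl ?_
  rw [sub_re, one_re, sub_pos]
  refine (hz ▸ re_le_norm z).lt_of_ne fun hre => hz1 ?_
  rw [eq_coe_norm_of_nonneg (z := z) ?_, hz, ofReal_one]
  exact re_eq_norm.1 (hre.trans hz.symm)

theorem dense_lerchCutPlane : Dense lerchCutPlane := by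
  refine Dense.mono (s₁ := {z : ℂ | z.im ≠ 0}) (fun z => mem_lerchCutPlane_of_im_ne_zero) ?_
  exact (dense_compl_singleton (0 : ℝ)).preimage isOpenMap_im

theorem mul_exp_neg_mem_lerchCutPlane {z : ℂ} (hz : z ∈ lerchCutPlane) {t : ℝ} (ht : 0 ≤ t) :
    z * exp (-t) ∈ lerchCutPlane := by
  have := starConvex_zero_iff.1 starConvex_lerchCutPlane hz (Real.exp_pos (-t)).le (by simpa)
  rwa [real_smul, mul_comm, ofReal_exp, ofReal_neg] at this

end CutPlane

section LerchPhi

theorem IsLerchContinuation.eqOn {s v : ℂ} {f g : ℂ → ℂ} (hf : IsLerchContinuation s v f)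
    (hg : IsLerchContinuation s v g) : EqOn f g lerchCutPlane := by
  refine (hf.1.analyticOnNhd isOpen_lerchCutPlane).eqOn_of_preconnected_of_eventuallyEq
    (hg.1.analyticOnNhd isOpen_lerchCutPlane) isPreconnected_lerchCutPlane
    zero_mem_lerchCutPlane ?_
  filter_upwards [Metric.ball_mem_nhds (0 : ℂ) one_pos] with z hz
  rw [mem_ball_zero_iff] at hz
  rw [hf.2 z hz, hg.2 z hz]

theorem IsLerchContinuation.hurwitzLerchPhi_eq {s v z : ℂ} {f : ℂ → ℂ}
    (hf : IsLerchContinuation s v f) (hz : z ≠ 1) (hc : ContinuousAt f z) :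
    hurwitzLerchPhi z s v = f z := by
  have hε : IsLerchContinuation s v (Classical.epsilon (IsLerchContinuation s v)) :=
    Classical.epsilon_spec ⟨f, hf⟩
  have : (𝓝[lerchCutPlane] z).NeBot :=
    mem_closure_iff_nhdsWithin_neBot.1 (dense_lerchCutPlane z)
  rw [hurwitzLerchPhi, if_neg hz]
  refine Tendsto.limUnder_eq (hc.continuousWithinAt.tendsto.congr' ?_)
  filter_upwards [self_mem_nhdsWithin] with w hw using hf.eqOn hε hw

theorem IsLerchContinuation.hurwitzLerchPhi_eq_of_mem {s v z : ℂ} {f : ℂ → ℂ}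
    (hf : IsLerchContinuation s v f) (hz : z ∈ lerchCutPlane) : hurwitzLerchPhi z s v = f z :=
  hf.hurwitzLerchPhi_eq (ne_one_of_mem_lerchCutPlane hz)
    (hf.1.continuousOn.continuousAt (isOpen_lerchCutPlane.mem_nhds hz))

theorem isLerchContinuation_lerchRational (v : ℂ) (N : ℕ) :
    IsLerchContinuation (-N) v (lerchRational v N) := by
  refine ⟨(differentiableOn_lerchRational v N).mono fun z hz => ne_one_of_mem_lerchCutPlane hz,
    fun z hz => ?_⟩
  rw [← (hasSum_lerchRational v N hz).tsum_eq]
  simp only [lerchSeries, neg_neg, cpow_natCast]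

theorem hurwitzLerchPhi_neg_natCast (v : ℂ) (N : ℕ) {z : ℂ} (hz : z ≠ 1) :
    hurwitzLerchPhi z (-N) v = lerchRational v N z :=
  (isLerchContinuation_lerchRational v N).hurwitzLerchPhi_eq hz
    ((differentiableOn_lerchRational v N).continuousOn.continuousAt
      (isOpen_compl_singleton.mem_nhds hz))

end LerchPhi

section LerchIntegral

/-- The function `e^(-vt) ∑ (v + j)^N (z e^(-t))^j`, with the sum continued beyond the unit disc;
its Mellin transform at `s + N` is `Γ(s + N)` times the Lerch series. -/
noncomputable def lerchKernel (v : ℂ) (N : ℕ) (z : ℂ) (t : ℝ) : ℂ :=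
  exp (-(v * t)) * lerchRational v N (z * exp (-t))

/-- The integral representation of `Φ(z, s, v)`, valid for `Re v > 0` and `Re s > -N`. -/
noncomputable def lerchIntegral (v : ℂ) (N : ℕ) (z s : ℂ) : ℂ :=
  (Gamma (s + N))⁻¹ * mellin (lerchKernel v N z) (s + N)

theorem continuousOn_lerchKernel (v : ℂ) (N : ℕ) {z : ℂ} (hz : z ∈ lerchCutPlane) :
    ContinuousOn (lerchKernel v N z) (Ioi 0) := by
  refine ContinuousOn.mul (by fun_prop) ((differentiableOn_lerchRational v N).continuousOn.comp
    (by fun_prop) fun t ht => ?_)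
  exact ne_one_of_mem_lerchCutPlane (mul_exp_neg_mem_lerchCutPlane hz (le_of_lt ht))

theorem exists_norm_lerchRational_smul_le (v : ℂ) (N : ℕ) {z₀ : ℂ} (hz₀ : z₀ ∈ lerchCutPlane) :
    ∃ V ∈ 𝓝 z₀, ∃ C : ℝ, ∀ z ∈ V, ∀ r ∈ Icc (0 : ℝ) 1, ‖lerchRational v N (r • z)‖ ≤ C := by
  obtain ⟨ε, hε, hball⟩ := Metric.nhds_basis_closedBall.mem_iff.1
    (isOpen_lerchCutPlane.mem_nhds hz₀)
  have hcompact : IsCompact ((fun p : ℝ × ℂ => p.1 • p.2) ''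
      (Icc (0 : ℝ) 1 ×ˢ Metric.closedBall z₀ ε)) :=
    (isCompact_Icc.prod (isCompact_closedBall z₀ ε)).image (by fun_prop)
  obtain ⟨C, hC⟩ := hcompact.exists_bound_of_continuousOn (f := lerchRational v N) <| by
    refine (differentiableOn_lerchRational v N).continuousOn.mono ?_
    rintro _ ⟨⟨r, w⟩, ⟨hr, hw⟩, rfl⟩
    exact ne_one_of_mem_lerchCutPlane
      (starConvex_zero_iff.1 starConvex_lerchCutPlane (hball hw) hr.1 hr.2)
  exact ⟨_, Metric.closedBall_mem_nhds z₀ hε, C, fun z hz r hr => hC _ ⟨(r, z), ⟨hr, hz⟩, rfl⟩⟩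

theorem exists_norm_lerchKernel_le (v : ℂ) (N : ℕ) {z₀ : ℂ} (hz₀ : z₀ ∈ lerchCutPlane) :
    ∃ V ∈ 𝓝 z₀, ∃ C : ℝ, ∀ z ∈ V, ∀ t : ℝ, 0 < t →
      ‖lerchKernel v N z t‖ ≤ C * Real.exp (-(v.re * t)) := by
  obtain ⟨V, hV, C, hC⟩ := exists_norm_lerchRational_smul_le v N hz₀
  refine ⟨V, hV, C, fun z hz t ht => ?_⟩
  rw [lerchKernel, norm_mul, norm_exp_neg_mul_ofReal, mul_comm]
  gcongr
  have hexp : Real.exp (-t) ∈ Icc (0 : ℝ) 1 := ⟨(Real.exp_pos _).le, by simpa using ht.le⟩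
  simpa [mul_comm] using hC z hz _ hexp

theorem differentiableOn_lerchIntegral {v s : ℂ} {N : ℕ} (hv : 0 < v.re) (hs : 0 < (s + N).re) :
    DifferentiableOn ℂ (fun z => lerchIntegral v N z s) lerchCutPlane := by
  refine (differentiableOn_mellin_of_exp_bound hs isOpen_lerchCutPlane
    (fun z => continuousOn_lerchKernel v N) (fun t ht => ?_) fun z₀ hz₀ => ?_).const_mul _
  · refine ((differentiableOn_lerchRational v N).comp (by fun_prop) fun z hz => ?_).const_mul _
    exact ne_one_of_mem_lerchCutPlane (mul_exp_neg_mem_lerchCutPlane hz ht.le)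
  · obtain ⟨V, hV, C, hC⟩ := exists_norm_lerchKernel_le v N hz₀
    exact ⟨V, hV, C, v.re, hv, hC⟩

theorem differentiableAt_lerchIntegral {v z s : ℂ} {N : ℕ} (hv : 0 < v.re)
    (hz : z ∈ lerchCutPlane) (hs : 0 < (s + N).re) :
    DifferentiableAt ℂ (lerchIntegral v N z) s := by
  obtain ⟨V, hV, C, hC⟩ := exists_norm_lerchKernel_le v N hz
  have hbound (t : ℝ) (ht : 0 < t) : ‖lerchKernel v N z t‖ ≤ C * Real.exp (-v.re * t) := by
    rw [neg_mul]
    exact hC z (mem_of_mem_nhds hV) t ht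
  have hexp : (fun t : ℝ => Real.exp (-v.re * t)) =O[𝓝[>] 0] fun t : ℝ => t ^ (-(0 : ℝ)) := by
    have hcont : Continuous fun t : ℝ => Real.exp (-v.re * t) := by fun_prop
    simpa using ((hcont.tendsto 0).mono_left nhdsWithin_le_nhds).isBigO_one ℝ
  refine DifferentiableAt.mul (differentiable_one_div_Gamma.differentiableAt.comp s
    (by fun_prop)) (DifferentiableAt.comp (g := mellin _) s ?_ (by fun_prop))
  refine mellin_differentiableAt_of_isBigO_rpow_exp hv
    ((continuousOn_lerchKernel v N hz).locallyIntegrableOn measurableSet_Ioi) ?_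
    (IsBigO.trans ?_ hexp) hs
  · refine IsBigO.of_bound C ?_
    filter_upwards [eventually_gt_atTop 0] with t ht
    rw [Real.norm_of_nonneg (Real.exp_pos _).le]
    exact hbound t ht
  · refine IsBigO.of_bound C ?_
    filter_upwards [self_mem_nhdsWithin] with t ht
    rw [Real.norm_of_nonneg (Real.exp_pos _).le]
    exact hbound t ht

theorem add_natCast_ne_zero_of_re_pos {v : ℂ} (hv : 0 < v.re) (j : ℕ) : v + j ≠ 0 :=
  ne_zero_of_re_pos (re_add_natCast_pos hv j)

theorem lerchIntegral_eq_lerchSeries {v z s : ℂ} {N : ℕ} (hv : 0 < v.re)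
    (h : LerchConvergent z s) (hs : 0 < (s + N).re) :
    lerchIntegral v N z s = lerchSeries z s v := by
  have hz : ‖z‖ ≤ 1 := h.elim le_of_lt And.left
  have hkernel (t : ℝ) (ht : 0 < t) : HasSum (fun j : ℕ => (v + j) ^ N * z ^ j * exp (-t) ^ j)
      (lerchRational v N (z * exp (-t))) := by
    have hlt : ‖z * exp (-t)‖ < 1 := by
      rw [norm_mul, ← ofReal_neg, norm_exp_ofReal]
      exact (mul_le_of_le_one_left (Real.exp_pos _).le hz).trans_lt (by simpa using ht)
    simpa only [mul_pow, mul_assoc] using hasSum_lerchRational v N hlt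
  have hsum := hasSum_mellin_exp_neg_mul hs hv hkernel
    (by simpa using summable_norm_pow_mul_rpow hv N h)
  have hcancel : (Gamma (s + N))⁻¹ * Gamma (s + N) = 1 :=
    inv_mul_cancel₀ (Gamma_ne_zero_of_re_pos hs)
  refine (hsum.mul_left (Gamma (s + N))⁻¹).tsum_eq.symm.trans (tsum_congr fun j => ?_)
  have hvj := add_natCast_ne_zero_of_re_pos hv j
  rw [← mul_assoc, hcancel, one_mul, neg_add, cpow_add _ _ hvj, cpow_neg _ (N : ℂ), cpow_natCast]
  field_simp

/-- A number of terms of the Lerch series whose removal moves the parameter into `Re v > 0`. -/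
noncomputable def lerchShift (v : ℂ) : ℕ := ⌈|v.re|⌉₊ + 1

theorem re_add_lerchShift_pos (v : ℂ) : 0 < (v + lerchShift v).re := by
  have := Nat.le_ceil |v.re|
  have := neg_abs_le v.re
  simp only [lerchShift, add_re, natCast_re, Nat.cast_add, Nat.cast_one, one_re]
  linarith

/-- The integral representation of `Φ(z, s, v)` for arbitrary `v`, valid for `Re s > -N`. -/
noncomputable def lerchContinuation (v : ℂ) (N : ℕ) (z s : ℂ) : ℂ :=
  ∑ j ∈ Finset.range (lerchShift v), (v + j) ^ (-s) * z ^ j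
    + z ^ lerchShift v * lerchIntegral (v + lerchShift v) N z s

theorem lerchContinuation_eq_lerchSeries {z s : ℂ} (v : ℂ) {N : ℕ} (h : LerchConvergent z s)
    (hs : 0 < (s + N).re) : lerchContinuation v N z s = lerchSeries z s v := by
  rw [lerchContinuation, lerchIntegral_eq_lerchSeries (re_add_lerchShift_pos v) h hs,
    ← lerchSeries_eq_sum_add v h]

theorem isLerchContinuation_lerchContinuation (v : ℂ) {s : ℂ} {N : ℕ} (hs : 0 < (s + N).re) :
    IsLerchContinuation s v (fun z => lerchContinuation v N z s) :=
  ⟨DifferentiableOn.add (by fun_prop) (DifferentiableOn.mul (by fun_prop)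
    (differentiableOn_lerchIntegral (re_add_lerchShift_pos v) hs)),
    fun _ hz => lerchContinuation_eq_lerchSeries v (Or.inl hz) hs⟩

theorem hurwitzLerchPhi_eq_lerchContinuation {v z s : ℂ} {N : ℕ} (hz : z ∈ lerchCutPlane)
    (hs : 0 < (s + N).re) : hurwitzLerchPhi z s v = lerchContinuation v N z s :=
  (isLerchContinuation_lerchContinuation v hs).hurwitzLerchPhi_eq_of_mem hz

theorem exists_re_add_natCast_pos (s : ℂ) : ∃ N : ℕ, 0 < (s + N).re := by
  obtain ⟨N, hN⟩ := exists_nat_gt (-s.re)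
  exact ⟨N, by rw [add_re, natCast_re]; linarith⟩

theorem hurwitzLerchPhi_eq_lerchSeries {z s : ℂ} (v : ℂ) (hz : z ∈ lerchCutPlane)
    (h : LerchConvergent z s) : hurwitzLerchPhi z s v = lerchSeries z s v := by
  obtain ⟨N, hN⟩ := exists_re_add_natCast_pos s
  rw [hurwitzLerchPhi_eq_lerchContinuation hz hN, lerchContinuation_eq_lerchSeries v h hN]

theorem differentiableOn_hurwitzLerchPhi (s v : ℂ) :
    DifferentiableOn ℂ (fun z => hurwitzLerchPhi z s v) lerchCutPlane := by
  obtain ⟨N, hN⟩ := exists_re_add_natCast_pos s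
  exact (isLerchContinuation_lerchContinuation v hN).1.congr
    fun z hz => hurwitzLerchPhi_eq_lerchContinuation hz hN

theorem add_natCast_ne_zero {v : ℂ} (hv : ∀ j : ℕ, v ≠ -j) (j : ℕ) : v + j ≠ 0 :=
  fun h => hv j (eq_neg_of_add_eq_zero_left h)

theorem differentiable_hurwitzLerchPhi {v z : ℂ} (hv : ∀ j : ℕ, v ≠ -j)
    (hz : z ∈ lerchCutPlane) : Differentiable ℂ fun s => hurwitzLerchPhi z s v := by
  intro s
  obtain ⟨N, hN⟩ := exists_re_add_natCast_pos s
  have hopen : IsOpen {s : ℂ | 0 < (s + N).re} := isOpen_lt continuous_const (by fun_prop)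
  have heq : (fun s => hurwitzLerchPhi z s v) =ᶠ[𝓝 s] lerchContinuation v N z := by
    filter_upwards [hopen.mem_nhds hN] with w hw using hurwitzLerchPhi_eq_lerchContinuation hz hw
  refine DifferentiableAt.congr_of_eventuallyEq ?_ heq
  refine DifferentiableAt.add (DifferentiableAt.fun_sum fun j _ => ?_)
    ((differentiableAt_lerchIntegral (re_add_lerchShift_pos v) hz hN).const_mul _)
  exact (differentiableAt_id.neg.const_cpow (Or.inl (add_natCast_ne_zero hv j))).mul_const _

end LerchIntegral

section AnalyticGluing

theorem exists_differentiable_of_monotone_cover {U : ℕ → Set ℂ} {G : ℕ → ℂ → ℂ}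
    (hopen : ∀ K, IsOpen (U K)) (hconn : ∀ K, IsPreconnected (U K)) (hmono : Monotone U)
    (hcover : ∀ s, ∃ K, s ∈ U K) (hne : (U 0).Nonempty) (hG : ∀ K, DifferentiableOn ℂ (G K) (U K))
    (heq : ∀ K, EqOn (G K) (G 0) (U 0)) :
    ∃ g : ℂ → ℂ, Differentiable ℂ g ∧ EqOn g (G 0) (U 0) := by
  have hle {K L : ℕ} (hKL : K ≤ L) : EqOn (G K) (G L) (U K) := by
    obtain ⟨s₀, hs₀⟩ := hne
    refine ((hG K).analyticOnNhd (hopen K)).eqOn_of_preconnected_of_eventuallyEq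
      (((hG L).mono (hmono hKL)).analyticOnNhd (hopen K)) (hconn K) (hmono K.zero_le hs₀) ?_
    exact ((heq K).trans (heq L).symm).eventuallyEq_of_mem ((hopen 0).mem_nhds hs₀)
  have hcompat {K L : ℕ} {s : ℂ} (hK : s ∈ U K) (hL : s ∈ U L) : G K s = G L s :=
    (le_total K L).elim (fun h => hle h hK) fun h => (hle h hL).symm
  choose κ hκ using hcover
  refine ⟨fun s => G (κ s) s, fun s => ?_, fun s hs => heq _ hs⟩
  have hnhds : U (κ s) ∈ 𝓝 s := (hopen _).mem_nhds (hκ s)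
  refine ((hG (κ s) s (hκ s)).differentiableAt hnhds).congr_of_eventuallyEq ?_
  filter_upwards [hnhds] with w hw using hcompat (hκ w) hw

end AnalyticGluing

section MellinContinuation

theorem hasMellin_pow_mul_exp_neg_mul {s v : ℂ} {k : ℕ} (hs : 0 < (s + k).re) (hv : 0 < v.re) :
    HasMellin (fun t : ℝ => (t : ℂ) ^ k * exp (-(v * t))) s
      (Gamma (s + k) * v ^ (-(s + k))) := by
  obtain ⟨hconv, heq⟩ := hasMellin_exp_neg_mul hs hv
  simpa only [HasMellin, cpow_natCast, smul_eq_mul] using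
    And.intro (MellinConvergent.cpow_smul.2 hconv) ((mellin_cpow_smul _ s k).trans heq)

/-- `e^(-vt)` times the remainder of `φ` after the first `K` terms of its expansion `∑ c k t^k` at
`0`. Its Mellin transform is analytic for `Re s > -K`. -/
noncomputable def expRemainder (φ : ℝ → ℂ) (c : ℕ → ℂ) (v : ℂ) (K : ℕ) (t : ℝ) : ℂ :=
  exp (-(v * t)) * (φ t - ∑ k ∈ Finset.range K, c k * (t : ℂ) ^ k)

theorem expRemainder_zero (φ : ℝ → ℂ) (c : ℕ → ℂ) (v : ℂ) :
    expRemainder φ c v 0 = fun t : ℝ => exp (-(v * t)) * φ t := by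
  ext t
  rw [expRemainder, Finset.sum_range_zero, sub_zero]

variable {φ : ℝ → ℂ} {c : ℕ → ℂ} {v : ℂ} {r : ℝ}

theorem locallyIntegrableOn_expRemainder (c : ℕ → ℂ) (v : ℂ) (K : ℕ)
    (hφ : ContinuousOn φ (Ioi 0)) : LocallyIntegrableOn (expRemainder φ c v K) (Ioi 0) := by
  refine ContinuousOn.locallyIntegrableOn ?_ measurableSet_Ioi
  exact ContinuousOn.mul (by fun_prop) (hφ.sub (by fun_prop))

theorem expRemainder_isBigO_atTop (c : ℕ → ℂ) (v : ℂ) (K : ℕ) (hr : 0 < r)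
    (hφ : φ =O[atTop] fun t => Real.exp (r * t)) :
    expRemainder φ c v K =O[atTop] fun t => Real.exp (-(v.re - r) * t) := by
  have hexp : (fun t : ℝ => exp (-(v * t))) =O[atTop] fun t : ℝ => Real.exp (-(v.re * t)) :=
    IsBigO.of_norm_le fun t => (norm_exp_neg_mul_ofReal v t).le
  have hpow (k : ℕ) : (fun t : ℝ => (t : ℂ) ^ k) =O[atTop] fun t : ℝ => Real.exp (r * t) := by
    simpa only [← ofReal_pow] using
      isBigO_ofReal_left.2 (isLittleO_pow_exp_pos_mul_atTop k hr).isBigO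
  refine (hexp.mul (hφ.sub (IsBigO.fun_sum fun k _ => (hpow k).const_mul_left (c k)))).congr_right
    fun t => ?_
  rw [← Real.exp_add]
  ring_nf

theorem expRemainder_isBigO_zero (v : ℂ) {K : ℕ}
    (hc : (fun t : ℝ => φ t - ∑ k ∈ Finset.range K, c k * (t : ℂ) ^ k)
      =O[𝓝[>] 0] fun t : ℝ => t ^ K) :
    expRemainder φ c v K =O[𝓝[>] 0] fun t : ℝ => t ^ (-(-K : ℝ)) := by
  have hcont : Continuous fun t : ℝ => exp (-(v * t)) := by fun_prop
  have hexp : (fun t : ℝ => exp (-(v * t))) =O[𝓝[>] 0] fun _ : ℝ => (1 : ℝ) :=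
    ((hcont.tendsto 0).mono_left nhdsWithin_le_nhds).isBigO_one ℝ
  exact (hexp.mul hc).congr_right fun t => by rw [one_mul, neg_neg, Real.rpow_natCast]

theorem mellin_expRemainder {s : ℂ} (hv : 0 < v.re) (hs : 0 < s.re)
    (hconv : ∀ K, MellinConvergent (expRemainder φ c v K) s) (K : ℕ) :
    mellin (expRemainder φ c v K) s = mellin (expRemainder φ c v 0) s
      - ∑ k ∈ Finset.range K, c k * (Gamma (s + k) * v ^ (-(s + k))) := by
  induction K with
  | zero => simp
  | succ K ih =>
    have hterm := hasMellin_pow_mul_exp_neg_mul (re_add_natCast_pos hs K) hv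
    have hstep : expRemainder φ c v (K + 1) = fun t =>
        expRemainder φ c v K t - c K • ((t : ℂ) ^ K * exp (-(v * t))) := by
      ext t
      simp only [expRemainder, Finset.sum_range_succ, smul_eq_mul]
      ring
    rw [hstep, (hasMellin_sub (hconv K) (hterm.1.const_smul _)).2, mellin_const_smul, hterm.2, ih,
      Finset.sum_range_succ, smul_eq_mul, sub_sub]

/-- The continuation of `Γ(s)⁻¹ ∫ t^(s-1) e^(-vt) φ(t) dt` to `Re s > -K`: the first `K` terms of
the expansion of `φ` at `0` are integrated in closed form. -/
noncomputable def mellinContinuation (φ : ℝ → ℂ) (c : ℕ → ℂ) (v : ℂ) (K : ℕ) (s : ℂ) : ℂ :=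
  (Gamma s)⁻¹ * mellin (expRemainder φ c v K) s
    + ∑ k ∈ Finset.range K, c k * ((ascPochhammer ℂ k).eval s * v ^ (-(s + k)))

theorem mellinContinuation_eq {s : ℂ} (hv : 0 < v.re) (hs : 0 < s.re)
    (hconv : ∀ K, MellinConvergent (expRemainder φ c v K) s) (K : ℕ) :
    mellinContinuation φ c v K s = mellinContinuation φ c v 0 s := by
  have hs0 (k : ℕ) : s ≠ -k := fun h => by
    have : s.re = -k := by rw [h, neg_re, natCast_re]
    linarith [(k.cast_nonneg : (0 : ℝ) ≤ k)]
  have hterm (k : ℕ) : c k * ((ascPochhammer ℂ k).eval s * v ^ (-(s + k)))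
      = (Gamma s)⁻¹ * (c k * (Gamma (s + k) * v ^ (-(s + k)))) := by
    rw [← Gamma_add_nat_div_Gamma_eq s hs0]
    ring
  simp only [mellinContinuation, hterm, mellin_expRemainder hv hs hconv K, Finset.range_zero,
    Finset.sum_empty, ← Finset.mul_sum]
  ring

theorem exists_differentiable_eq_mellin (hr : 0 < r) (hrv : r < v.re)
    (hcont : ContinuousOn φ (Ioi 0)) (htop : φ =O[atTop] fun t => Real.exp (r * t))
    (hzero : ∀ K : ℕ, (fun t : ℝ => φ t - ∑ k ∈ Finset.range K, c k * (t : ℂ) ^ k)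
      =O[𝓝[>] 0] fun t : ℝ => t ^ K) :
    ∃ g : ℂ → ℂ, Differentiable ℂ g ∧ ∀ s : ℂ, 0 < s.re →
      g s = (Gamma s)⁻¹ * mellin (fun t : ℝ => exp (-(v * t)) * φ t) s := by
  have hv : 0 < v.re := hr.trans hrv
  have hloc (K : ℕ) := locallyIntegrableOn_expRemainder c v K hcont
  have hdecay (K : ℕ) := expRemainder_isBigO_atTop c v K hr htop
  have hrem (K : ℕ) := expRemainder_isBigO_zero v (hzero K)
  have hconv (K : ℕ) {s : ℂ} (hs : 0 < s.re) : MellinConvergent (expRemainder φ c v K) s :=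
    mellinConvergent_of_isBigO_rpow_exp (sub_pos.2 hrv) (hloc K) (hdecay K) (hrem K)
      ((neg_nonpos.2 K.cast_nonneg).trans_lt hs)
  have hdiff (K : ℕ) : DifferentiableOn ℂ (mellinContinuation φ c v K)
      {s : ℂ | -(K : ℝ) < s.re} := fun s hs =>
    DifferentiableAt.differentiableWithinAt <| DifferentiableAt.add
      (differentiable_one_div_Gamma.differentiableAt.mul <|
        mellin_differentiableAt_of_isBigO_rpow_exp (sub_pos.2 hrv) (hloc K) (hdecay K) (hrem K) hs)
      (DifferentiableAt.fun_sum fun k _ => DifferentiableAt.const_mul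
        ((Polynomial.differentiable _).differentiableAt.mul
          (DifferentiableAt.const_cpow (by fun_prop) (Or.inl (ne_zero_of_re_pos hv)))) _)
  have heq (K : ℕ) : EqOn (mellinContinuation φ c v K) (mellinContinuation φ c v 0)
      {s : ℂ | -((0 : ℕ) : ℝ) < s.re} := fun s hs => by
    have hs0 : 0 < s.re := by simpa using hs
    exact mellinContinuation_eq hv hs0 (fun K => hconv K hs0) K
  obtain ⟨g, hg, hgs⟩ := exists_differentiable_of_monotone_cover
    (U := fun K : ℕ => {s : ℂ | -(K : ℝ) < s.re})
    (fun K => isOpen_lt continuous_const continuous_re)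
    (fun K => (convex_halfSpace_re_gt _).isPreconnected)
    (fun K L hKL s (hs : -(K : ℝ) < s.re) => (neg_le_neg (Nat.cast_le.2 hKL)).trans_lt hs)
    (fun s => (exists_nat_gt (-s.re)).imp fun K hK => neg_lt.1 hK) ⟨1, by simp⟩ hdiff heq
  refine ⟨g, hg, fun s hs => (hgs (by simpa using hs)).trans ?_⟩
  rw [mellinContinuation, Finset.sum_range_zero, add_zero, expRemainder_zero]

end MellinContinuation

section Hurwitz

theorem one_sub_exp_neg_ne_zero {t : ℝ} (ht : 0 < t) : 1 - exp (-(t : ℂ)) ≠ 0 := by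
  refine sub_ne_zero.2 fun h => ?_
  have hnorm : Real.exp (-t) = 1 := by
    rw [← norm_exp_ofReal, ofReal_neg, ← h, norm_one]
  rw [Real.exp_eq_one_iff] at hnorm
  linarith

theorem exists_isBigO_div_one_sub_exp_neg :
    ∃ c : ℕ → ℂ, ∀ K : ℕ,
      (fun t : ℝ => t / (1 - exp (-t)) - ∑ k ∈ Finset.range K, c k * (t : ℂ) ^ k)
        =O[𝓝[>] 0] fun t : ℝ => t ^ K := by
  set f : ℂ → ℂ := fun t => 1 - exp (-t) with hf
  have hderiv : HasDerivAt f 1 0 := by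
    simpa using ((hasDerivAt_neg (0 : ℂ)).cexp).const_sub 1
  have hquot : AnalyticAt ℂ (dslope f 0) 0 := by
    obtain ⟨q, hq⟩ : AnalyticAt ℂ f 0 := by fun_prop
    exact hq.has_fpower_series_dslope_fslope.analyticAt
  obtain ⟨p, hp⟩ := hquot.inv (by rw [dslope_same, hderiv.deriv]; exact one_ne_zero)
  refine ⟨p.coeff, fun K => ?_⟩
  have hof : Tendsto (fun t : ℝ => (t : ℂ)) (𝓝[>] 0) (𝓝 0) :=
    (continuous_ofReal.tendsto' 0 0 ofReal_zero).mono_left nhdsWithin_le_nhds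
  refine ((hp.isBigO_sub_partialSum_pow K).comp_tendsto hof).congr' ?_ ?_
  · filter_upwards [self_mem_nhdsWithin] with t ht
    have ht0 : (t : ℂ) ≠ 0 := ofReal_ne_zero.2 (ne_of_gt ht)
    simp only [Function.comp_apply, zero_add, Pi.inv_apply, FormalMultilinearSeries.partialSum,
      FormalMultilinearSeries.apply_eq_pow_smul_coeff, smul_eq_mul, dslope_of_ne _ ht0,
      slope_def_field, hf, neg_zero, exp_zero, sub_self, sub_zero, inv_div, mul_comm]
  · filter_upwards [self_mem_nhdsWithin] with t ht
    rw [Function.comp_apply, Complex.norm_of_nonneg (le_of_lt ht)]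

theorem div_one_sub_exp_neg_isBigO_atTop {r : ℝ} (hr : 0 < r) :
    (fun t : ℝ => (t : ℂ) / (1 - exp (-t))) =O[atTop] fun t => Real.exp (r * t) := by
  have hid : (fun t : ℝ => (t : ℂ)) =O[atTop] fun t => Real.exp (r * t) :=
    isBigO_ofReal_left.2 (by simpa using (isLittleO_pow_exp_pos_mul_atTop 1 hr).isBigO)
  have hinv : Tendsto (fun t : ℝ => (1 - exp (-(t : ℂ)))⁻¹) atTop (𝓝 (1 - 0)⁻¹) := by
    refine Tendsto.inv₀ (Tendsto.const_sub 1 ?_) (by simp)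
    simpa [Function.comp_def] using
      (continuous_ofReal.tendsto' 0 0 ofReal_zero).comp Real.tendsto_exp_neg_atTop_nhds_zero
  exact (hid.mul (hinv.isBigO_one ℝ)).congr_right fun t => mul_one _

theorem mellin_div_one_sub_exp_neg {v s : ℂ} (hv : 0 < v.re) (hs : 1 < s.re) :
    mellin (fun t : ℝ => exp (-(v * t)) * (t / (1 - exp (-t)))) (s - 1)
      = Gamma s * lerchSeries 1 s v := by
  have hs0 : 0 < s.re := one_pos.trans hs
  have hseries := lerchIntegral_eq_lerchSeries (N := 0) hv (Or.inr ⟨norm_one.le, hs⟩)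
    (by simpa using hs0)
  rw [lerchIntegral, Nat.cast_zero, add_zero,
    inv_mul_eq_iff_eq_mul₀ (Gamma_ne_zero_of_re_pos hs0)] at hseries
  rw [← hseries, ← sub_add_cancel s 1, ← mellin_cpow_smul, sub_add_cancel]
  congr 1
  ext t
  rw [lerchKernel, lerchRational, cpow_one, smul_eq_mul, one_mul]
  ring

theorem exists_differentiable_eq_sub_one_mul_lerchSeries {v : ℂ} (hv : 0 < v.re) :
    ∃ g : ℂ → ℂ, Differentiable ℂ g ∧ ∀ s : ℂ, 1 < s.re → g s = (s - 1) * lerchSeries 1 s v := by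
  obtain ⟨c, hc⟩ := exists_isBigO_div_one_sub_exp_neg
  obtain ⟨g, hg, hgs⟩ := exists_differentiable_eq_mellin
    (φ := fun t : ℝ => t / (1 - exp (-t))) (half_pos hv) (half_lt_self hv)
    (ContinuousOn.div (by fun_prop) (by fun_prop) fun t ht => one_sub_exp_neg_ne_zero ht)
    (div_one_sub_exp_neg_isBigO_atTop (half_pos hv)) hc
  refine ⟨fun s => g (s - 1), hg.comp (by fun_prop), fun s hs => ?_⟩
  have hs1 : 0 < (s - 1).re := by simpa using hs
  have hΓ : Gamma s = (s - 1) * Gamma (s - 1) := by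
    rw [← Gamma_add_one _ (ne_zero_of_re_pos hs1), sub_add_cancel]
  have hΓ0 : Gamma (s - 1) ≠ 0 := Gamma_ne_zero_of_re_pos hs1
  simp only [hgs _ hs1, mellin_div_one_sub_exp_neg hv hs, hΓ]
  field_simp

theorem exists_isHurwitzContinuation {v : ℂ} (hv : ∀ j : ℕ, v ≠ -j) :
    ∃ g, IsHurwitzContinuation v g := by
  obtain ⟨g, hg, hgs⟩ :=
    exists_differentiable_eq_sub_one_mul_lerchSeries (re_add_lerchShift_pos v)
  refine ⟨fun s => ∑ j ∈ Finset.range (lerchShift v), (v + j) ^ (-s) + g s / (s - 1),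
    fun s hs => ?_, fun s hs => ?_⟩
  · refine DifferentiableAt.differentiableWithinAt (DifferentiableAt.add
      (DifferentiableAt.fun_sum fun j _ => ?_)
      (DifferentiableAt.div (hg s) (by fun_prop) (sub_ne_zero.2 hs)))
    exact differentiableAt_id.neg.const_cpow (Or.inl (add_natCast_ne_zero hv j))
  · have hs1 : s - 1 ≠ 0 := ne_zero_of_re_pos (by simpa using hs)
    simp only [hgs s hs, mul_div_cancel_left₀ _ hs1,
      lerchSeries_eq_sum_add v (Or.inr ⟨norm_one.le, hs⟩) (lerchShift v), one_pow, mul_one, one_mul]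

theorem isHurwitzContinuation_hurwitzLerchPhi {v : ℂ} (hv : ∀ j : ℕ, v ≠ -j) :
    IsHurwitzContinuation v (fun s => hurwitzLerchPhi 1 s v) := by
  simpa only [hurwitzLerchPhi, if_true] using
    Classical.epsilon_spec (exists_isHurwitzContinuation hv)

end Hurwitz

section UnitCircle

theorem hurwitzLerchPhi_eq_lerchSeries_of_norm_eq_one {z s v : ℂ} (hv : ∀ j : ℕ, v ≠ -j)
    (hz : ‖z‖ = 1) (hs : 1 < s.re) : hurwitzLerchPhi z s v = lerchSeries z s v := by
  by_cases hz1 : z = 1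
  · rw [hz1]
    exact (isHurwitzContinuation_hurwitzLerchPhi hv).2 s hs
  · exact hurwitzLerchPhi_eq_lerchSeries v (mem_lerchCutPlane_of_norm_eq_one hz hz1)
      (Or.inr ⟨hz.le, hs⟩)

theorem differentiableOn_hurwitzLerchPhi_of_norm_eq_one {z v : ℂ} (hv : ∀ j : ℕ, v ≠ -j)
    (hz : ‖z‖ = 1) : DifferentiableOn ℂ (fun s => hurwitzLerchPhi z s v) {1}ᶜ := by
  by_cases hz1 : z = 1
  · rw [hz1]
    exact (isHurwitzContinuation_hurwitzLerchPhi hv).1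
  · exact (differentiable_hurwitzLerchPhi hv
      (mem_lerchCutPlane_of_norm_eq_one hz hz1)).differentiableOn

end UnitCircle

section Multiplication

theorem ofReal_mul_cpow {r : ℝ} (hr : 0 < r) (w s : ℂ) :
    ((r : ℂ) * w) ^ s = (r : ℂ) ^ s * w ^ s := by
  rcases eq_or_ne w 0 with rfl | hw
  · rcases eq_or_ne s 0 with rfl | hs <;> simp [*]
  · have hr0 : (r : ℂ) ≠ 0 := ofReal_ne_zero.2 hr.ne'
    rw [cpow_def_of_ne_zero (mul_ne_zero hr0 hw), cpow_def_of_ne_zero hr0, cpow_def_of_ne_zero hw,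
      log_ofReal_mul hr hw, ofReal_log hr.le, ← exp_add, add_mul]

theorem LerchConvergent.pow {z s : ℂ} (h : LerchConvergent z s) {q : ℕ} (hq : q ≠ 0) :
    LerchConvergent (z ^ q) s := by
  rw [LerchConvergent, norm_pow]
  exact h.imp (fun hz => pow_lt_one₀ (norm_nonneg z) hz hq)
    (And.imp_left fun hz => pow_le_one₀ (norm_nonneg z) hz)

theorem lerchSeries_multiplication {z s : ℂ} (v : ℂ) {q : ℕ} (hq : q ≠ 0)
    (h : LerchConvergent z s) :
    lerchSeries z s v
      = (q : ℂ) ^ (-s) * ∑ r ∈ Finset.range q, z ^ r * lerchSeries (z ^ q) s ((v + r) / q) := by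
  obtain ⟨n, rfl⟩ := Nat.exists_eq_succ_of_ne_zero hq
  have hq0 : ((n + 1 : ℕ) : ℂ) ≠ 0 := Nat.cast_ne_zero.2 hq
  have hterm (r j : ℕ) : (v + ((r + (n + 1) * j : ℕ) : ℂ)) ^ (-s) * z ^ (r + (n + 1) * j)
      = ((n + 1 : ℕ) : ℂ) ^ (-s)
        * (z ^ r * (((v + r) / (n + 1 : ℕ) + j) ^ (-s) * (z ^ (n + 1)) ^ j)) := by
    have hbase : v + ((r + (n + 1) * j : ℕ) : ℂ)
        = ((n + 1 : ℕ) : ℝ) * ((v + r) / (n + 1 : ℕ) + j) := by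
      push_cast at hq0 ⊢
      field_simp
      ring
    rw [hbase, ofReal_mul_cpow (Nat.cast_pos.2 n.succ_pos), ofReal_natCast, pow_add, pow_mul]
    ring
  rw [lerchSeries, Nat.sumByResidueClasses (summable_norm_lerchSeries v h).of_norm (n + 1),
    Finset.mul_sum, Finset.sum_range]
  refine Finset.sum_congr rfl fun r _ => ?_
  rw [lerchSeries, ← tsum_mul_left, ← tsum_mul_left]
  exact tsum_congr fun j => hterm _ j

theorem add_natCast_div_ne_neg_natCast {v : ℂ} (hv : ∀ j : ℕ, v ≠ -j) {q : ℕ} (hq : q ≠ 0)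
    (r j : ℕ) : (v + r) / q ≠ -j := by
  intro h
  rw [div_eq_iff (Nat.cast_ne_zero.2 hq)] at h
  refine hv (r + j * q) ?_
  push_cast
  linear_combination h

open scoped ComplexOrder in
theorem mem_lerchCutPlane_of_pow {z : ℂ} {q : ℕ} (hz : z ^ q ∈ lerchCutPlane) :
    z ∈ lerchCutPlane := by
  rw [lerchCutPlane, mem_ofPred_eq, mem_slitPlane_iff_not_le_zero, sub_nonpos] at hz ⊢
  exact fun h => hz (one_le_pow₀ h)

theorem isPreconnected_preimage_pow_lerchCutPlane {q : ℕ} (hq : q ≠ 0) :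
    IsPreconnected ((fun z : ℂ => z ^ q) ⁻¹' lerchCutPlane) := by
  have hstar : StarConvex ℝ 0 ((fun z : ℂ => z ^ q) ⁻¹' lerchCutPlane) := by
    rw [starConvex_zero_iff]
    intro z hz r hr0 hr1
    rw [mem_preimage, smul_pow]
    exact starConvex_zero_iff.1 starConvex_lerchCutPlane hz (pow_nonneg hr0 q) (pow_le_one₀ hr0 hr1)
  have hzero : (0 : ℂ) ^ q ∈ lerchCutPlane := by simpa [hq] using zero_mem_lerchCutPlane
  exact (hstar.isPathConnected hzero).isConnected.isPreconnected

theorem isPreconnected_preimage_pow_compl_one {q : ℕ} (hq : q ≠ 0) :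
    IsPreconnected ((fun z : ℂ => z ^ q) ⁻¹' {1}ᶜ) := by
  have hfin : ((fun z : ℂ => z ^ q) ⁻¹' {1}).Finite := by
    refine (Polynomial.nthRootsFinset q (1 : ℂ)).finite_toSet.subset fun z hz => ?_
    exact (Polynomial.mem_nthRootsFinset hq.bot_lt 1).2 hz
  exact (hfin.countable.isPathConnected_compl_of_one_lt_rank (by simp)).isConnected.isPreconnected

theorem hurwitzLerchPhi_multiplication_of_mem {W : Set ℂ} {z s : ℂ} (v : ℂ) {q : ℕ} (hq : q ≠ 0)
    (hWopen : IsOpen W) (hW0 : (0 : ℂ) ∈ W) (hWpow : (fun z : ℂ => z ^ q) ⁻¹' W ⊆ W)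
    (hWconn : IsPreconnected ((fun z : ℂ => z ^ q) ⁻¹' W))
    (hdiff : ∀ v, DifferentiableOn ℂ (fun z => hurwitzLerchPhi z s v) W) (hz : z ^ q ∈ W) :
    hurwitzLerchPhi z s v
      = (q : ℂ) ^ (-s)
        * ∑ r ∈ Finset.range q, z ^ r * hurwitzLerchPhi (z ^ q) s ((v + r) / q) := by
  have hopen : IsOpen ((fun z : ℂ => z ^ q) ⁻¹' W) := hWopen.preimage (continuous_pow q)
  have hrhs : DifferentiableOn ℂ (fun z => (q : ℂ) ^ (-s)
      * ∑ r ∈ Finset.range q, z ^ r * hurwitzLerchPhi (z ^ q) s ((v + r) / q))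
      ((fun z : ℂ => z ^ q) ⁻¹' W) :=
    (DifferentiableOn.fun_sum fun r _ => (differentiableOn_pow r).mul
      ((hdiff _).comp (differentiableOn_pow q) fun z hz => hz)).const_mul _
  refine (((hdiff v).mono hWpow).analyticOnNhd hopen).eqOn_of_preconnected_of_eventuallyEq
    (hrhs.analyticOnNhd hopen) hWconn (z₀ := 0) (by simpa [hq] using hW0) ?_ hz
  filter_upwards [Metric.ball_mem_nhds (0 : ℂ) one_pos] with x hx
  rw [mem_ball_zero_iff] at hx
  have hconv : LerchConvergent x s := Or.inl hx
  have hxq : ‖x ^ q‖ < 1 := by simpa only [norm_pow] using pow_lt_one₀ (norm_nonneg x) hx hq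
  simp only [hurwitzLerchPhi_eq_lerchSeries _ (mem_lerchCutPlane_of_norm_lt_one hx) hconv,
    hurwitzLerchPhi_eq_lerchSeries _ (mem_lerchCutPlane_of_norm_lt_one hxq) (hconv.pow hq),
    lerchSeries_multiplication v hq hconv]

theorem hurwitzLerchPhi_multiplication_of_norm_eq_one {z s v : ℂ} (hv : ∀ j : ℕ, v ≠ -j) {q : ℕ}
    (hq : q ≠ 0) (hz : ‖z‖ = 1) (hs : s ≠ 1) :
    hurwitzLerchPhi z s v
      = (q : ℂ) ^ (-s)
        * ∑ r ∈ Finset.range q, z ^ r * hurwitzLerchPhi (z ^ q) s ((v + r) / q) := by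
  have hzq : ‖z ^ q‖ = 1 := by rw [norm_pow, hz, one_pow]
  have hvq := add_natCast_div_ne_neg_natCast hv hq
  have hrhs : DifferentiableOn ℂ (fun s => (q : ℂ) ^ (-s)
      * ∑ r ∈ Finset.range q, z ^ r * hurwitzLerchPhi (z ^ q) s ((v + r) / q)) {1}ᶜ :=
    (differentiable_id.neg.const_cpow (Or.inl (Nat.cast_ne_zero.2 hq))).differentiableOn.mul
      (DifferentiableOn.fun_sum fun r _ =>
        (differentiableOn_hurwitzLerchPhi_of_norm_eq_one (hvq r) hzq).const_mul _)
  have hlhs := differentiableOn_hurwitzLerchPhi_of_norm_eq_one hv hz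
  refine (hlhs.analyticOnNhd isOpen_compl_singleton).eqOn_of_preconnected_of_eventuallyEq
    (hrhs.analyticOnNhd isOpen_compl_singleton)
    (isConnected_compl_singleton_of_one_lt_rank (by simp) _).isPreconnected (z₀ := 2) (by simp)
    ?_ hs
  have hnhds : {s : ℂ | 1 < s.re} ∈ 𝓝 2 :=
    (isOpen_lt continuous_const continuous_re).mem_nhds (by simp)
  filter_upwards [hnhds] with s hs
  simp only [hurwitzLerchPhi_eq_lerchSeries_of_norm_eq_one hv hz hs,
    hurwitzLerchPhi_eq_lerchSeries_of_norm_eq_one (hvq _) hzq hs,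
    lerchSeries_multiplication v hq (Or.inr ⟨hz.le, hs⟩)]

theorem hurwitzLerchPhi_multiplication {z s v : ℂ} {q : ℕ} (hq : q ≠ 0)
    (h : LerchAdmissible (z ^ q) s v) :
    hurwitzLerchPhi z s v
      = (q : ℂ) ^ (-s)
        * ∑ r ∈ Finset.range q, z ^ r * hurwitzLerchPhi (z ^ q) s ((v + r) / q) := by
  obtain ⟨hv, hz | ⟨hz, hs⟩ | ⟨hz, N, rfl⟩⟩ := h
  · exact hurwitzLerchPhi_multiplication_of_mem v hq isOpen_lerchCutPlane zero_mem_lerchCutPlane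
      (fun z => mem_lerchCutPlane_of_pow) (isPreconnected_preimage_pow_lerchCutPlane hq)
      (differentiableOn_hurwitzLerchPhi s) hz
  · exact hurwitzLerchPhi_multiplication_of_norm_eq_one hv hq (norm_eq_one_of_pow_eq_one hz hq) hs
  · refine hurwitzLerchPhi_multiplication_of_mem v hq isOpen_compl_singleton zero_ne_one
      (fun z hz => ?_) (isPreconnected_preimage_pow_compl_one hq) (fun v => ?_) hz
    · rintro rfl
      exact hz (one_pow q)
    · exact (differentiableOn_lerchRational v N).congr
        fun z hz => hurwitzLerchPhi_neg_natCast v N hz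

theorem LerchAdmissible.of_pow {z s v v' : ℂ} {q : ℕ} (hq : q ≠ 0) (hv : ∀ j : ℕ, v ≠ -j)
    (h : LerchAdmissible (z ^ q) s v') : LerchAdmissible z s v := by
  refine ⟨hv, ?_⟩
  obtain ⟨-, hz | ⟨hz, hs⟩ | ⟨hz, hs⟩⟩ := h
  · exact Or.inl (mem_lerchCutPlane_of_pow hz)
  · by_cases hz1 : z = 1
    · exact Or.inr (Or.inl ⟨hz1, hs⟩)
    · exact Or.inl (mem_lerchCutPlane_of_norm_eq_one (norm_eq_one_of_pow_eq_one hz hq) hz1)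
  · refine Or.inr (Or.inr ⟨?_, hs⟩)
    rintro rfl
    exact hz (one_pow q)

theorem hurwitzLerchPhi_duplication {z s v : ℂ} (h : LerchAdmissible (z ^ 2) s v) :
    hurwitzLerchPhi z s v
      = 2 ^ (-s) * (hurwitzLerchPhi (z ^ 2) s (v / 2)
        + z * hurwitzLerchPhi (z ^ 2) s ((v + 1) / 2)) := by
  simpa [Finset.sum_range_succ] using hurwitzLerchPhi_multiplication two_ne_zero h

end Multiplication

section Telescoping

theorem hurwitzLerchPhi_neg_sq_sub_neg {w s u : ℂ} (h : LerchAdmissible (w ^ 4) s u) :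
    2 ^ (-s) * w * hurwitzLerchPhi (-w ^ 2) s ((u + 1) / 2) - hurwitzLerchPhi (-w) s u
      = 2 * (2 ^ (-s)) ^ 2 * w * hurwitzLerchPhi (w ^ 4) s ((u + 1) / 4)
        - 2 ^ (-s) * hurwitzLerchPhi (w ^ 2) s (u / 2) := by
  have hsq : (w ^ 2) ^ 2 = w ^ 4 := by ring
  have hnegsq : (-w ^ 2) ^ 2 = w ^ 4 := by ring
  have hu : (u + 1) / 2 / 2 = (u + 1) / 4 := by ring
  have hv : ∀ j : ℕ, (u + 1) / 2 ≠ -j := by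
    simpa using add_natCast_div_ne_neg_natCast h.1 two_ne_zero 1
  have hneg := hurwitzLerchPhi_duplication (z := -w) (s := s) (v := u)
    (by rw [neg_sq]; exact .of_pow two_ne_zero h.1 (hsq ▸ h))
  have hpos := hurwitzLerchPhi_duplication (z := w ^ 2) (s := s) (v := (u + 1) / 2)
    (hsq ▸ ⟨hv, h.2⟩)
  have hneg' := hurwitzLerchPhi_duplication (z := -w ^ 2) (s := s) (v := (u + 1) / 2)
    (hnegsq ▸ ⟨hv, h.2⟩)
  rw [neg_sq] at hneg
  rw [hsq, hu] at hpos
  rw [hnegsq, hu] at hneg'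
  rw [hneg]
  linear_combination 2 ^ (-s) * w * (hpos + hneg')

/-- Consecutive differences of these terms are the summands of the theorem, with `l = log a`. Up to
normalization the term is the Lerch series over odd indices
`2^(-p) ∑ (i 2^(-p) (2j + 1) + l)^k e^(i 2^(-p) (2j + 1) m)`. -/
noncomputable def lerchTelescope (k l m : ℂ) (p : ℤ) : ℂ :=
  2 ^ (-p) * (I * 2 ^ (-p)) ^ k * exp (I * 2 ^ (-p) * m)
    * hurwitzLerchPhi (exp (I * 2 ^ (1 - p) * m)) (-k) ((1 - I * 2 ^ p * l) / 2)

theorem exp_two_zpow_add_natCast (c m : ℂ) (e : ℤ) (j : ℕ) :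
    exp (c * 2 ^ (e + j) * m) = exp (c * 2 ^ e * m) ^ 2 ^ j := by
  rw [← exp_nat_mul, zpow_add₀ two_ne_zero, zpow_natCast]
  push_cast
  ring_nf

theorem mul_two_zpow_add_one_cpow (c k : ℂ) (e : ℤ) :
    (c * 2 ^ (e + 1)) ^ k = 2 ^ k * (c * 2 ^ e) ^ k := by
  have h : c * 2 ^ (e + 1) = ((2 : ℝ) : ℂ) * (c * 2 ^ e) := by
    rw [zpow_add_one₀ two_ne_zero, ofReal_ofNat]
    ring
  rw [h, ofReal_mul_cpow two_pos, ofReal_ofNat]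

theorem lerchTelescope_neg_one (k l m : ℂ) :
    lerchTelescope k l m (-1)
      = I ^ k * 2 ^ (k + 1) * exp (2 * I * m)
        * hurwitzLerchPhi (exp (4 * I * m)) (-k) (1 / 2 - 1 / 4 * I * l) := by
  have hv : (1 - I * 2 ^ (-1 : ℤ) * l) / 2 = 1 / 2 - 1 / 4 * I * l := by
    rw [zpow_neg_one]
    ring
  have hpow : (I * 2 ^ (1 : ℤ)) ^ k = 2 ^ k * I ^ k := by
    simpa using mul_two_zpow_add_one_cpow I k 0
  have hfour : I * 2 ^ (1 - -1 : ℤ) * m = 4 * I * m := by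
    rw [show (1 - -1 : ℤ) = (2 : ℕ) by rfl, zpow_natCast]
    ring
  rw [lerchTelescope, hv, hfour, neg_neg, hpow, zpow_one, mul_comm I 2,
    cpow_add _ _ two_ne_zero, cpow_one]
  ring

theorem neg_lerchTelescope (k l m : ℂ) (p : ℤ) :
    -lerchTelescope k l m p
      = I * (I * 2 ^ (-p)) ^ (k + 1) * exp (I * m * 2 ^ (-p))
        * hurwitzLerchPhi (exp (I * 2 ^ (1 - p) * m)) (-k) (1 / 2 * (1 - I * 2 ^ p * l)) := by
  rw [lerchTelescope, cpow_add _ _ (mul_ne_zero I_ne_zero (zpow_ne_zero _ two_ne_zero)), cpow_one,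
    mul_right_comm I m, one_div_mul_eq_div]
  linear_combination -(2 ^ (-p) * (I * 2 ^ (-p)) ^ k * exp (I * 2 ^ (-p) * m)
    * hurwitzLerchPhi (exp (I * 2 ^ (1 - p) * m)) (-k) ((1 - I * 2 ^ p * l) / 2)) * I_sq

theorem lerchTelescope_pred_sub (k l m : ℂ) (p : ℤ)
    (h : LerchAdmissible (exp (I * 2 ^ (2 - p) * m)) (-k) (1 - I * 2 ^ p * l)) :
    lerchTelescope k l m (p - 1) - lerchTelescope k l m p
      = 2 ^ (-p) * exp (I * m * 2 ^ (-p))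
        * ((I * 2 ^ (-p)) ^ k * exp (I * m * 2 ^ (-p))
            * hurwitzLerchPhi (-exp (I * 2 ^ (1 - p) * m)) (-k) (1 - I * 2 ^ (p - 1) * l)
          - (I * 2 ^ (-p - 1)) ^ k
            * hurwitzLerchPhi (-exp (I * 2 ^ (-p) * m)) (-k) (1 - I * 2 ^ p * l)) := by
  set w := exp (I * 2 ^ (-p) * m) with hw
  have hw2 : exp (I * 2 ^ (1 - p) * m) = w ^ 2 := by
    have hexp := exp_two_zpow_add_natCast I m (-p) 1
    rwa [Nat.cast_one, neg_add_eq_sub, pow_one] at hexp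
  have hw4 : exp (I * 2 ^ (2 - p) * m) = w ^ 4 := by
    rw [hw, show 4 = 2 ^ 2 by rfl, ← exp_two_zpow_add_natCast, Nat.cast_two, neg_add_eq_sub]
  have hpow : (I * 2 ^ (-p)) ^ k = 2 ^ k * (I * 2 ^ (-p - 1)) ^ k := by
    rw [← mul_two_zpow_add_one_cpow, sub_add_cancel]
  have hpow' : (I * 2 ^ (1 - p)) ^ k = 2 ^ k * (I * 2 ^ (-p)) ^ k := by
    rw [← mul_two_zpow_add_one_cpow, neg_add_eq_sub]
  have htwo : (2 : ℂ) ^ (1 - p) = 2 * 2 ^ (-p) := by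
    rw [← zpow_one_add₀ two_ne_zero, sub_eq_add_neg]
  have htwo' : (2 : ℂ) ^ p = 2 * 2 ^ (p - 1) := by
    rw [← zpow_one_add₀ two_ne_zero, add_sub_cancel]
  have hu : (1 - I * 2 ^ p * l + 1) / 2 = 1 - I * 2 ^ (p - 1) * l := by
    rw [htwo']
    ring
  have hu' : (1 - I * 2 ^ p * l + 1) / 4 = (1 - I * 2 ^ (p - 1) * l) / 2 := by
    rw [htwo']
    ring
  have hstep := hurwitzLerchPhi_neg_sq_sub_neg (hw4 ▸ h)
  rw [neg_neg, hu, hu'] at hstep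
  rw [lerchTelescope, lerchTelescope, neg_sub, show 1 - (p - 1) = 2 - p by ring, hw4, hw2,
    mul_right_comm I m, ← hw, hpow', hpow, htwo]
  linear_combination -(2 ^ (-p) * w * (I * 2 ^ (-p - 1)) ^ k) * hstep

end Telescoping

theorem mainTheorem1 (k a m : ℂ) (n : ℕ) (hn : 0 < n)
    (loga : ℂ) (hloga : Complex.exp loga = a)
    (h₁ : ∀ p ∈ Finset.range (n + 1),
      LerchAdmissible (-Complex.exp (Complex.I * (2 : ℂ) ^ (1 - (p : ℤ)) * m)) (-k)
        (1 - Complex.I * (2 : ℂ) ^ ((p : ℤ) - 1) * loga))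
    (h₂ : ∀ p ∈ Finset.range (n + 1),
      LerchAdmissible (-Complex.exp (Complex.I * (2 : ℂ) ^ (-(p : ℤ)) * m)) (-k)
        (1 - Complex.I * (2 : ℂ) ^ (p : ℤ) * loga))
    (h₃ : LerchAdmissible (Complex.exp (Complex.I * (2 : ℂ) ^ (1 - (n : ℤ)) * m)) (-k)
        (1 / 2 * (1 - Complex.I * (2 : ℂ) ^ (n : ℤ) * loga)))
    (h₄ : LerchAdmissible (Complex.exp (4 * Complex.I * m)) (-k)
        (1 / 2 - 1 / 4 * Complex.I * loga)) :
    ∑ p ∈ Finset.range (n + 1),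
      (2 : ℂ) ^ (-(p : ℤ)) * Complex.exp (Complex.I * m * (2 : ℂ) ^ (-(p : ℤ))) *
        ((Complex.I * (2 : ℂ) ^ (-(p : ℤ))) ^ k *
            Complex.exp (Complex.I * m * (2 : ℂ) ^ (-(p : ℤ))) *
            hurwitzLerchPhi (-Complex.exp (Complex.I * (2 : ℂ) ^ (1 - (p : ℤ)) * m)) (-k)
              (1 - Complex.I * (2 : ℂ) ^ ((p : ℤ) - 1) * loga)
          - (Complex.I * (2 : ℂ) ^ (-(p : ℤ) - 1)) ^ k *
            hurwitzLerchPhi (-Complex.exp (Complex.I * (2 : ℂ) ^ (-(p : ℤ)) * m)) (-k)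
              (1 - Complex.I * (2 : ℂ) ^ (p : ℤ) * loga))
    = Complex.I * (Complex.I * (2 : ℂ) ^ (-(n : ℤ))) ^ (k + 1) *
          Complex.exp (Complex.I * m * (2 : ℂ) ^ (-(n : ℤ))) *
          hurwitzLerchPhi (Complex.exp (Complex.I * (2 : ℂ) ^ (1 - (n : ℤ)) * m)) (-k)
            (1 / 2 * (1 - Complex.I * (2 : ℂ) ^ (n : ℤ) * loga))
      + Complex.I ^ k * (2 : ℂ) ^ (k + 1) * Complex.exp (2 * Complex.I * m) *
          hurwitzLerchPhi (Complex.exp (4 * Complex.I * m)) (-k)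
            (1 / 2 - 1 / 4 * Complex.I * loga) := by
  have hadm (p : ℕ) (hp : p ∈ Finset.range (n + 1)) :
      LerchAdmissible (exp (I * 2 ^ (2 - (p : ℤ)) * m)) (-k) (1 - I * 2 ^ (p : ℤ) * loga) := by
    have hpow : exp (I * 2 ^ (2 - (p : ℤ)) * m) ^ 2 ^ p = exp (4 * I * m) := by
      rw [← exp_two_zpow_add_natCast, sub_add_cancel, mul_comm I]
      norm_num
    exact .of_pow (pow_ne_zero p two_ne_zero) (h₂ p hp).1 (hpow ▸ h₄)
  rw [Finset.sum_congr rfl fun p hp => (lerchTelescope_pred_sub k loga m _ (hadm p hp)).symm,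
    ← neg_lerchTelescope, ← lerchTelescope_neg_one]
  have htelescope := Finset.sum_range_sub' (fun p : ℕ => lerchTelescope k loga m (p - 1)) (n + 1)
  simpa [neg_add_eq_sub] using htelescope
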